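/- Let $\mathcal H_2$ be the space of $2\times2$ complex Hermitian matrices and $\mathcal H_2^+\subset\mathcal H_2$ the set of positive definite ones, with $d\mathbf X=dx_{11}\,dx_{22}\,d(\Re x_{12})\,d(\Im x_{12})$. Write $|\cdot|$ for the determinant, $\mathrm{etr}(\cdot)=\exp(\mathrm{tr}(\cdot))$, $(a)_t=a(a+1)\cdots(a+t-1)$, and $\tilde\Gamma_2(a)=\pi\,\Gamma(a)\Gamma(a-1)$. Let $\mathcal C_n^\nu$ be the ultraspherical (Gegenbauer) polynomial, determined by $(1-2xr+r^2)^{-\nu}=\sum_{n\ge0}\mathcal C_n^\nu(x)r^n$, equivalently $\mathcal C_n^\nu(x)=\sum_{k=0}^{\lfloor n/2\rfloor}(-1)^k\frac{(\nu)_{n-k}}{k!\,(n-2k)!}(2x)^{n-2k}$. Let $\mathbf A\in\mathcal H_2^+$ and let $\mathbf R\in\mathcal H_2$ have rank one. Then for all integers $p,t\ge0$ and all complex $a$ with $\Re(a)>1$, the following integral converges absolutely and $$\int_{\mathbf X\in\mathcal H_2^+}\mathrm{etr}(-\mathbf A\mathbf X)\,\mathrm{tr}^p(\mathbf X)\,|\mathbf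 X|^{a-2}\,\mathrm{tr}^t(\mathbf R\mathbf X)\,d\mathbf X =p!\,\frac{(a)_t\,\tilde\Gamma_2(a)}{|\mathbf A|^{a+\frac p2}}\sum_{k=0}^{\min(p,t)}\frac{(-1)^k\binom tk}{|\mathbf A|^{\frac k2}}\,\mathrm{tr}^{t-k}(\mathbf R\mathbf A^{-1})\,\mathrm{tr}^k(\mathbf R)\,\mathcal C_{p-k}^{a+t}\!\left(\frac{\mathrm{tr}(\mathbf A)}{2\sqrt{|\mathbf A|}}\right).$$ -/

import Mathlib

open MeasureTheory
open scoped ComplexOrder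

noncomputable section

/-- The `2 × 2` Hermitian matrix with diagonal entries `x 1`, `x 2` and upper right entry `z`.
As `(x₁, x₂, z)` runs over `ℝ × ℝ × ℂ`, it runs exactly once over all `2 × 2` Hermitian
matrices, and the volume of `ℝ × ℝ × ℂ` is the usual Lebesgue measure
`dX = dx₁₁ dx₂₂ d(Re x₁₂) d(Im x₁₂)`. -/
def herm2 (c : ℝ × ℝ × ℂ) : Matrix (Fin 2) (Fin 2) ℂ :=
  !![(c.1 : ℂ), c.2.2; star c.2.2, (c.2.1 : ℂ)]

/-- The coordinates of the `2 × 2` Hermitian positive definite matrices. -/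
def posDefCone2 : Set (ℝ × ℝ × ℂ) :=
  {c | (herm2 c).PosDef}

/-- The complex multivariate gamma function
`π ^ (m (m - 1) / 2) * ∏_{j = 1}^m Γ (a - j + 1)`. -/
def complexMultiGamma (m : ℕ) (a : ℂ) : ℂ :=
  (Real.pi : ℂ) ^ (m * (m - 1) / 2) * ∏ j ∈ Finset.Icc 1 m, Complex.Gamma (a - (j : ℂ) + 1)

/-- The ultraspherical (Gegenbauer) polynomial of degree `n` with parameter `ν`, i.e.
`∑_{k = 0}^{⌊n / 2⌋} (-1) ^ k * (ν)_{n - k} / (k! (n - 2 k)!) * (2 X) ^ (n - 2 k)`,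
the coefficient of `r ^ n` in `(1 - 2 X r + r ^ 2) ^ (-ν)`. -/
def gegenbauer (ν : ℂ) (n : ℕ) : Polynomial ℂ :=
  ∑ k ∈ Finset.range (n / 2 + 1),
    Polynomial.C ((-1) ^ k * (ascPochhammer ℂ (n - k)).eval ν /
      ((k.factorial : ℂ) * ((n - 2 * k).factorial : ℂ))) * (2 * Polynomial.X) ^ (n - 2 * k)

/-- The function `X ↦ etr (-A X) * tr (X) ^ p * |X| ^ (a - 2) * tr (R X) ^ t`. -/
def traceIntegrand (A R : Matrix (Fin 2) (Fin 2) ℂ) (p t : ℕ) (a : ℂ)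
    (X : Matrix (Fin 2) (Fin 2) ℂ) : ℂ :=
  Complex.exp (-(A * X).trace) * X.trace ^ p * X.det ^ (a - 2) * (R * X).trace ^ t

end

/-! Everything follows from the Laplace transform of a power of the determinant on the cone,
`setIntegral_coneDensity`: ∫ etr(-BX) |X|^(a-2) dX = π Γ(a) Γ(a-1) |B|^(-a). Replacing B by B - sR
inserts etr(sRX), so t derivatives in s at 0 produce tr(RX)^t. Since R is singular, |B - sR| = |B| -
s tr(R adj B) is linear in s, and the derivative is (a)_t tr(R adj B)^t |B|^(-(a+t)), up to the
gamma factors.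

Now take B = A - rI and differentiate p times in r at 0, which produces tr(X)^p. Here tr(R adj B) =
tr(R adj A) - r tr R is linear and |B| = |A| - r tr A + r² is a rescaled Gegenbauer generating
function. Leibniz's rule (`iteratedDeriv_linear_pow_mul_quadratic_cpow`) gives the sum over k, and
adj A = |A| A⁻¹ gives the stated form.

The cone is open, so A - εI stays in it for small ε. This leaves the exponential moments that
justify convergence and differentiation under the integral (`hasDerivAt_integral_pow_mul_exp_mul`).
-/

/-! ### Hermitian 2 × 2 matrices and the positive cone in real coordinates. -/

/-- The determinant of `herm2 c`. -/
noncomputable def hermDet (c : ℝ × ℝ × ℂ) : ℝ := c.1 * c.2.1 - ‖c.2.2‖ ^ 2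

/-- The trace pairing of `herm2 b` and `herm2 c`. -/
noncomputable def hermPair (b c : ℝ × ℝ × ℂ) : ℝ :=
  b.1 * c.1 + b.2.1 * c.2.1 + 2 * inner ℝ b.2.2 c.2.2

theorem inner_complex_eq (w z : ℂ) : inner ℝ w z = w.re * z.re + w.im * z.im := by
  simp [Complex.inner]; ring

theorem sq_norm_complex_eq (z : ℂ) : ‖z‖ ^ 2 = z.re ^ 2 + z.im ^ 2 := by
  rw [Complex.sq_norm, Complex.normSq_apply]; ring

theorem det_herm2 (c : ℝ × ℝ × ℂ) : (herm2 c).det = (hermDet c : ℂ) := by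
  simp only [herm2, hermDet, Matrix.det_fin_two_of, sq_norm_complex_eq]
  apply Complex.ext
  · simp [pow_two]
  · simp [pow_two]
    ring

theorem trace_herm2 (c : ℝ × ℝ × ℂ) : (herm2 c).trace = ((c.1 + c.2.1 : ℝ) : ℂ) := by
  simp [herm2, Matrix.trace_fin_two]

theorem trace_herm2_mul (b c : ℝ × ℝ × ℂ) :
    (herm2 b * herm2 c).trace = (hermPair b c : ℂ) := by
  simp only [herm2, hermPair, Matrix.trace_fin_two, Matrix.mul_apply, Fin.sum_univ_two,
    inner_complex_eq]
  apply Complex.ext <;> simp <;> ring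

theorem isHermitian_herm2 (c : ℝ × ℝ × ℂ) : (herm2 c).IsHermitian := by
  ext i j; fin_cases i <;> fin_cases j <;> simp [herm2]

theorem exists_herm2_eq {A : Matrix (Fin 2) (Fin 2) ℂ} (hA : A.IsHermitian) :
    ∃ b, herm2 b = A := by
  refine ⟨((A 0 0).re, (A 1 1).re, A 0 1), ?_⟩
  have h0 := hA.apply 0 0
  have h1 := hA.apply 1 1
  have h2 := hA.apply 1 0
  ext i j
  fin_cases i <;> fin_cases j
  · simpa [herm2] using Complex.conj_eq_iff_re.1 h0
  · simp [herm2]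
  · simpa [herm2] using h2
  · simpa [herm2] using Complex.conj_eq_iff_re.1 h1

theorem posDef_herm2_iff (c : ℝ × ℝ × ℂ) : (herm2 c).PosDef ↔ 0 < c.1 ∧ 0 < hermDet c := by
  constructor
  · intro h
    refine ⟨?_, ?_⟩
    · simpa [herm2] using h.diag_pos (i := 0)
    · simpa [det_herm2] using h.det_pos
  · rintro ⟨h1, h2⟩
    refine Matrix.PosDef.of_dotProduct_mulVec_pos (isHermitian_herm2 c) fun v hv => ?_
    obtain ⟨x, y, z⟩ := c
    have key : star v ⬝ᵥ (herm2 (x, y, z)).mulVec v =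
        ((x * (‖v 0‖ ^ 2) + y * ‖v 1‖ ^ 2 +
          2 * ((z.re * (v 0).re + z.im * (v 0).im) * (v 1).re +
            (z.re * (v 0).im - z.im * (v 0).re) * (v 1).im) : ℝ) : ℂ) := by
      simp only [herm2, dotProduct, Matrix.mulVec, Fin.sum_univ_two, sq_norm_complex_eq]
      apply Complex.ext <;> simp [pow_two] <;> ring
    rw [key]
    norm_cast
    simp only [hermDet, sq_norm_complex_eq] at h1 h2 ⊢
    -- Multiplying the form by x completes the square without division: a squared modulus plus the
    -- determinant times |v 1|².
    have hx : 0 < x * (x * ((v 0).re ^ 2 + (v 0).im ^ 2) + y * ((v 1).re ^ 2 + (v 1).im ^ 2) +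
          2 * ((z.re * (v 0).re + z.im * (v 0).im) * (v 1).re +
            (z.re * (v 0).im - z.im * (v 0).re) * (v 1).im)) := by
      have e : x * (x * ((v 0).re ^ 2 + (v 0).im ^ 2) + y * ((v 1).re ^ 2 + (v 1).im ^ 2) +
          2 * ((z.re * (v 0).re + z.im * (v 0).im) * (v 1).re +
            (z.re * (v 0).im - z.im * (v 0).re) * (v 1).im)) =
          (x * (v 0).re + z.re * (v 1).re - z.im * (v 1).im) ^ 2 +
          (x * (v 0).im + z.re * (v 1).im + z.im * (v 1).re) ^ 2 +
          (x * y - (z.re ^ 2 + z.im ^ 2)) * ((v 1).re ^ 2 + (v 1).im ^ 2) := by ring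
      rw [e]
      by_cases hv1 : v 1 = 0
      · have hv0 : v 0 ≠ 0 := by
          intro h0; apply hv; ext i; fin_cases i <;> simp [h0, hv1]
        have : 0 < ‖v 0‖ ^ 2 := by positivity
        rw [sq_norm_complex_eq] at this
        simp only [hv1, Complex.zero_re, Complex.zero_im]
        have := mul_pos (pow_pos h1 2) this
        nlinarith
      · have : 0 < ‖v 1‖ ^ 2 := by positivity
        rw [sq_norm_complex_eq] at this
        positivity
    exact pos_of_mul_pos_right hx h1.le

theorem mem_posDefCone2_iff (c : ℝ × ℝ × ℂ) : c ∈ posDefCone2 ↔ 0 < c.1 ∧ 0 < hermDet c :=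
  posDef_herm2_iff c

theorem snd_pos_of_hermDet_pos {c : ℝ × ℝ × ℂ} (h1 : 0 < c.1) (h2 : 0 < hermDet c) :
    0 < c.2.1 := by
  have : 0 < c.1 * c.2.1 := by unfold hermDet at h2; nlinarith [sq_nonneg ‖c.2.2‖]
  exact pos_of_mul_pos_right this h1.le

theorem continuous_hermDet : Continuous hermDet := by unfold hermDet; fun_prop

theorem continuous_hermPair (b : ℝ × ℝ × ℂ) : Continuous (hermPair b) := by
  unfold hermPair; fun_prop

theorem isOpen_posDefCone2 : IsOpen posDefCone2 := by
  have : posDefCone2 = {c | 0 < c.1} ∩ {c | 0 < hermDet c} := by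
    ext c; exact mem_posDefCone2_iff c
  rw [this]
  exact (isOpen_lt continuous_const continuous_fst).inter
    (isOpen_lt continuous_const continuous_hermDet)

/-- On the cone the trace dominates every linear functional, because 2|z| < 2√(xy) ≤ x + y. A margin
in the trace direction therefore controls all directions. -/
theorem abs_hermPair_le {c : ℝ × ℝ × ℂ} (h1 : 0 < c.1) (h2 : 0 < hermDet c) (q : ℝ × ℝ × ℂ) :
    |hermPair q c| ≤ (|q.1| + |q.2.1| + ‖q.2.2‖) * (c.1 + c.2.1) := by
  have hy := snd_pos_of_hermDet_pos h1 h2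
  have hi := abs_real_inner_le_norm q.2.2 c.2.2
  have hz : 2 * ‖c.2.2‖ ≤ c.1 + c.2.1 := by
    unfold hermDet at h2
    nlinarith [sq_nonneg (c.1 - c.2.1), norm_nonneg c.2.2]
  have a1 : |q.1 * c.1| ≤ |q.1| * (c.1 + c.2.1) := by
    rw [abs_mul, abs_of_pos h1]; gcongr; linarith
  have a2 : |q.2.1 * c.2.1| ≤ |q.2.1| * (c.1 + c.2.1) := by
    rw [abs_mul, abs_of_pos hy]; gcongr; linarith
  have a3 : |2 * inner ℝ q.2.2 c.2.2| ≤ ‖q.2.2‖ * (c.1 + c.2.1) := by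
    rw [abs_mul, abs_two]
    calc 2 * |inner ℝ q.2.2 c.2.2| ≤ 2 * (‖q.2.2‖ * ‖c.2.2‖) := by gcongr
      _ = ‖q.2.2‖ * (2 * ‖c.2.2‖) := by ring
      _ ≤ _ := by gcongr
  unfold hermPair
  calc _ ≤ |q.1 * c.1| + |q.2.1 * c.2.1| + |2 * inner ℝ q.2.2 c.2.2| := abs_add_three _ _ _
    _ ≤ _ := by linarith

/-! ### Differentiation under the integral sign from exponential moments. -/

theorem pow_mul_exp_le {x ε : ℝ} (hε : 0 < ε) (hx : 0 ≤ x) (n : ℕ) :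
    x ^ n ≤ n.factorial / ε ^ n * Real.exp (ε * x) := by
  have h := Real.pow_div_factorial_le_exp (x := ε * x) (by positivity) n
  rw [mul_pow] at h
  rw [div_mul_eq_mul_div, le_div_iff₀ (by positivity)]
  rw [div_le_iff₀ (by positivity)] at h
  linarith

section ExponentialMoments

variable {α : Type*} [MeasurableSpace α] {μ : Measure α} {m : α → ℝ} {h : α → ℂ} {δ : ℝ}

theorem aestronglyMeasurable_of_exp_mul (hm : Measurable m)
    (hint : Integrable (fun x => (Real.exp (δ * |m x|) : ℂ) * h x) μ) :
    AEStronglyMeasurable h μ := by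
  have h1 : AEStronglyMeasurable (fun x => (Real.exp (-(δ * |m x|)) : ℂ)) μ :=
    (by fun_prop : Measurable (fun x => (Real.exp (-(δ * |m x|)) : ℂ))).aestronglyMeasurable
  refine (h1.mul hint.1).congr (ae_of_all _ fun x => ?_)
  simp only [Pi.mul_apply]
  rw [← mul_assoc, ← Complex.ofReal_mul, ← Real.exp_add]
  simp

theorem norm_pow_mul_exp_mul_le {r ε : ℝ} (hε : 0 < ε) (hr : |r| + ε ≤ δ) (p : ℕ) (x : ℝ) (z : ℂ) :
    ‖(x : ℂ) ^ p * Real.exp (r * x) * z‖ ≤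
      p.factorial / ε ^ p * ‖(Real.exp (δ * |x|) : ℂ) * z‖ := by
  simp only [norm_mul, norm_pow, Complex.norm_real, Real.norm_eq_abs, Real.abs_exp]
  rw [← mul_assoc]
  have hrx : r * x ≤ |r| * |x| := by rw [← abs_mul]; exact le_abs_self _
  refine mul_le_mul_of_nonneg_right ?_ (norm_nonneg z)
  calc |x| ^ p * Real.exp (r * x)
      ≤ (p.factorial / ε ^ p * Real.exp (ε * |x|)) * Real.exp (|r| * |x|) := by
        gcongr
        exact pow_mul_exp_le hε (abs_nonneg x) p
    _ = p.factorial / ε ^ p * Real.exp ((|r| + ε) * |x|) := by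
        rw [mul_assoc, ← Real.exp_add]; ring_nf
    _ ≤ _ := by gcongr

theorem integrable_pow_mul_exp_mul (hm : Measurable m)
    (hint : Integrable (fun x => (Real.exp (δ * |m x|) : ℂ) * h x) μ) {r : ℝ} (hr : |r| < δ)
    (p : ℕ) : Integrable (fun x => (m x : ℂ) ^ p * Real.exp (r * m x) * h x) μ := by
  refine (hint.norm.const_mul (p.factorial / (δ - |r|) ^ p)).mono' ?_ ?_
  · have h1 : Measurable (fun x => (m x : ℂ) ^ p * (Real.exp (r * m x) : ℂ)) := by fun_prop
    exact h1.aestronglyMeasurable.mul (aestronglyMeasurable_of_exp_mul hm hint)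
  · exact ae_of_all _ fun x => norm_pow_mul_exp_mul_le (by linarith) (by linarith) p _ _

theorem hasDerivAt_integral_pow_mul_exp_mul (hm : Measurable m)
    (hint : Integrable (fun x => (Real.exp (δ * |m x|) : ℂ) * h x) μ) {r : ℝ} (hr : |r| < δ)
    (p : ℕ) : HasDerivAt (fun r : ℝ => ∫ x, (m x : ℂ) ^ p * Real.exp (r * m x) * h x ∂μ)
      (∫ x, (m x : ℂ) ^ (p + 1) * Real.exp (r * m x) * h x ∂μ) r := by
  -- Half of the gap bounds how far s may move from r; the other half absorbs the polynomial factor.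
  have hε : 0 < (δ - |r|) / 2 := by linarith
  have hmeas : ∀ (p : ℕ) (r : ℝ),
      AEStronglyMeasurable (fun x => (m x : ℂ) ^ p * Real.exp (r * m x) * h x) μ := by
    intro p r
    have h1 : Measurable (fun x => (m x : ℂ) ^ p * (Real.exp (r * m x) : ℂ)) := by fun_prop
    exact h1.aestronglyMeasurable.mul (aestronglyMeasurable_of_exp_mul hm hint)
  refine (hasDerivAt_integral_of_dominated_loc_of_deriv_le
    (F := fun (r : ℝ) x => (m x : ℂ) ^ p * Real.exp (r * m x) * h x)
    (F' := fun (r : ℝ) x => (m x : ℂ) ^ (p + 1) * Real.exp (r * m x) * h x)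
    (Metric.ball_mem_nhds r hε) (.of_forall fun r => hmeas p r)
    (integrable_pow_mul_exp_mul hm hint hr p) (hmeas (p + 1) r)
    (ae_of_all _ fun x s hs => ?_)
    (hint.norm.const_mul ((p + 1).factorial / ((δ - |r|) / 2) ^ (p + 1)))
    (ae_of_all _ fun x s _ => ?_)).2
  · refine norm_pow_mul_exp_mul_le hε ?_ (p + 1) _ _
    rw [Metric.mem_ball, Real.dist_eq] at hs
    have := abs_sub_abs_le_abs_sub s r
    linarith
  · have h1 : HasDerivAt (fun s : ℝ => Real.exp (s * m x)) (Real.exp (s * m x) * m x) s := by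
      simpa using ((hasDerivAt_id s).mul_const (m x)).exp
    have h2 := (h1.ofReal_comp.const_mul ((m x : ℂ) ^ p)).mul_const (h x)
    convert! h2 using 1
    push_cast; ring

theorem iteratedDeriv_integral_exp_mul (hm : Measurable m)
    (hint : Integrable (fun x => (Real.exp (δ * |m x|) : ℂ) * h x) μ) (p : ℕ) :
    ∀ {r : ℝ}, |r| < δ → iteratedDeriv p (fun r : ℝ => ∫ x, Real.exp (r * m x) * h x ∂μ) r =
      ∫ x, (m x : ℂ) ^ p * Real.exp (r * m x) * h x ∂μ := by
  induction p with
  | zero => intro r _; simp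
  | succ p ih =>
    intro r hr
    rw [iteratedDeriv_succ, ← (hasDerivAt_integral_pow_mul_exp_mul hm hint hr p).deriv]
    apply Filter.EventuallyEq.deriv_eq
    filter_upwards [(isOpen_lt continuous_abs continuous_const).mem_nhds hr] with s hs
    exact ih hs

end ExponentialMoments

/-! ### The Laplace transform of a power of the determinant. -/

theorem integrableOn_cpow_mul_exp_neg_mul {a : ℂ} (ha : 0 < a.re) {r : ℝ} (hr : 0 < r) :
    IntegrableOn (fun x : ℝ => (x : ℂ) ^ (a - 1) * Complex.exp (-(r * x))) (Set.Ioi 0) := by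
  have h := integrableOn_rpow_mul_exp_neg_mul_rpow (p := 1) (s := a.re - 1) (by linarith)
    one_pos hr
  refine h.mono' ?_ ?_
  · have : Measurable (fun x : ℝ => (x : ℂ) ^ (a - 1) * Complex.exp (-(r * x))) := by fun_prop
    exact this.aestronglyMeasurable
  · filter_upwards [ae_restrict_mem measurableSet_Ioi] with x hx
    rw [norm_mul, Complex.norm_cpow_eq_rpow_re_of_pos hx, Complex.norm_exp]
    simp

/-- The shear map `((x, z), v) ↦ (x, v + ‖z‖ ^ 2 / x, z)`. -/
noncomputable def coneShear (p : (ℝ × ℂ) × ℝ) : ℝ × ℝ × ℂ :=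
  (p.1.1, p.2 + ‖p.1.2‖ ^ 2 / p.1.1, p.1.2)

/-- For fixed (x, z) the map is a translation in v. The new variable v is the Schur complement, so
for x > 0 the determinant becomes xv and the cone becomes v > 0. -/
theorem measurePreserving_coneShear : MeasurePreserving coneShear := by
  have h1 : MeasurePreserving
      (fun p : (ℝ × ℂ) × ℝ => (p.1, p.2 + ‖p.1.2‖ ^ 2 / p.1.1)) := by
    refine (MeasurePreserving.id (volume : Measure (ℝ × ℂ))).skew_product
      (g := fun (q : ℝ × ℂ) (v : ℝ) => v + ‖q.2‖ ^ 2 / q.1) ?_ (ae_of_all _ fun q => ?_)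
    · simp only [Function.uncurry_def]; fun_prop
    · exact (measurePreserving_add_right volume (‖q.2‖ ^ 2 / q.1)).map_eq
  have h2 : MeasurePreserving (MeasurableEquiv.prodAssoc : (ℝ × ℂ) × ℝ ≃ᵐ ℝ × ℂ × ℝ) :=
    measurePreserving_prodAssoc volume volume volume
  have h3 : MeasurePreserving (Prod.map id Prod.swap : ℝ × ℂ × ℝ → ℝ × ℝ × ℂ) :=
    (MeasurePreserving.id volume).prod Measure.measurePreserving_swap
  exact (h3.comp h2).comp h1

/-- The part of the sheared cone integrand that depends on `(x, z)`. -/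
noncomputable def coneSlice (b : ℝ × ℝ × ℂ) (a : ℂ) (x : ℝ) (z : ℂ) : ℂ :=
  (x : ℂ) ^ (a - 2) * Complex.exp (-(b.1 * x)) *
    Complex.exp (-((b.2.1 / x : ℝ) : ℂ) * ‖z‖ ^ 2 + (-2) * (inner ℝ b.2.2 z : ℝ))

theorem integrable_coneSlice {b : ℝ × ℝ × ℂ} (hb : 0 < b.2.1) (a : ℂ) {x : ℝ} (hx : 0 < x) :
    Integrable (coneSlice b a x) := by
  refine (GaussianFourier.integrable_cexp_neg_mul_sq_norm_add ?_ (-2) b.2.2).const_mul _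
  rw [Complex.ofReal_re]; positivity

/-- The planar Gaussian contributes πx / b₂₂, which raises the exponent of x by one; completing the
square replaces b₁₁ by the Schur complement |b| / b₂₂. -/
theorem integral_coneSlice {b : ℝ × ℝ × ℂ} (hb : 0 < b.2.1) (a : ℂ) {x : ℝ} (hx : 0 < x) :
    ∫ z, coneSlice b a x z = (Real.pi / b.2.1 : ℝ) *
      ((x : ℂ) ^ (a - 1) * Complex.exp (-((hermDet b / b.2.1 : ℝ) * x))) := by
  have hbx : 0 < (((b.2.1 / x : ℝ)) : ℂ).re := by rw [Complex.ofReal_re]; positivity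
  have hx' : (x : ℂ) ≠ 0 := by exact_mod_cast hx.ne'
  have hb' : (b.2.1 : ℂ) ≠ 0 := by exact_mod_cast hb.ne'
  simp only [coneSlice]
  rw [integral_const_mul, GaussianFourier.integral_cexp_neg_mul_sq_norm_add hbx,
    Complex.finrank_real_complex]
  have e1 : (a - 1) = (a - 2) + 1 := by ring
  rw [e1, Complex.cpow_add _ _ hx', Complex.cpow_one]
  have e2 : ((2 : ℕ) / 2 : ℂ) = 1 := by norm_num
  rw [e2, Complex.cpow_one]
  have e3 : Complex.exp (-(b.1 * x)) *
      Complex.exp ((-2) ^ 2 * (‖b.2.2‖ : ℂ) ^ 2 / (4 * ((b.2.1 / x : ℝ) : ℂ))) =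
      Complex.exp (-((hermDet b / b.2.1 : ℝ) * x)) := by
    rw [← Complex.exp_add]
    congr 1
    simp only [hermDet]
    push_cast
    field_simp
    ring
  rw [← e3]
  push_cast
  field_simp

/-- Taking moduli only replaces a by its real part, so absolute integrability follows from the same
Gaussian evaluation. -/
theorem norm_coneSlice (b : ℝ × ℝ × ℂ) (a : ℂ) {x : ℝ} (hx : 0 < x) (z : ℂ) :
    (‖coneSlice b a x z‖ : ℂ) = coneSlice b (a.re : ℂ) x z := by
  simp only [coneSlice, norm_mul, Complex.norm_cpow_eq_rpow_re_of_pos hx, Complex.norm_exp]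
  push_cast [Complex.ofReal_cpow hx.le]
  congr 3
  · simp
  · simp
  · simp [pow_two]

theorem measurable_coneSlice (b : ℝ × ℝ × ℂ) (a : ℂ) :
    Measurable (fun p : ℝ × ℂ => coneSlice b a p.1 p.2) := by
  unfold coneSlice; fun_prop

theorem integrable_indicator_coneSlice {b : ℝ × ℝ × ℂ} (hb : 0 < b.2.1) (hd : 0 < hermDet b)
    {a : ℂ} (ha : 0 < a.re) :
    Integrable (fun p : ℝ × ℂ =>
      (Set.Ioi (0 : ℝ)).indicator (fun x => coneSlice b a x p.2) p.1) := by
  have hmeas : Measurable (fun p : ℝ × ℂ =>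
      (Set.Ioi (0 : ℝ)).indicator (fun x => coneSlice b a x p.2) p.1) :=
    (measurable_coneSlice b a).indicator (measurable_fst measurableSet_Ioi)
  refine (integrable_prod_iff hmeas.aestronglyMeasurable).2 ⟨ae_of_all _ fun x => ?_, ?_⟩
  · by_cases hx : 0 < x
    · simpa [hx] using integrable_coneSlice hb a hx
    · simp [hx]
  · have h := (integrableOn_cpow_mul_exp_neg_mul (a := (a.re : ℂ)) (by simpa using ha)
      (div_pos hd hb)).const_mul ((Real.pi / b.2.1 : ℝ) : ℂ)
    have h' := ((integrable_indicator_iff measurableSet_Ioi).2 h).norm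
    refine h'.congr (ae_of_all _ fun x => ?_)
    by_cases hx : 0 < x
    · simp only [Set.mem_Ioi, hx, Set.indicator_of_mem]
      rw [← integral_coneSlice hb (a.re : ℂ) hx]
      simp_rw [← norm_coneSlice b a hx]
      rw [integral_complex_ofReal, Complex.norm_real, Real.norm_of_nonneg]
      exact integral_nonneg fun _ => norm_nonneg _
    · simp [hx]

theorem integral_indicator_coneSlice {b : ℝ × ℝ × ℂ} (hb : 0 < b.2.1) (hd : 0 < hermDet b)
    {a : ℂ} (ha : 0 < a.re) :
    ∫ p : ℝ × ℂ, (Set.Ioi (0 : ℝ)).indicator (fun x => coneSlice b a x p.2) p.1 =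
      (Real.pi / b.2.1 : ℝ) * ((1 / (hermDet b / b.2.1 : ℝ)) ^ a * Complex.Gamma a) := by
  have h0 := integrable_indicator_coneSlice hb hd ha
  rw [Measure.volume_eq_prod] at h0 ⊢
  rw [integral_prod _ h0, ← Complex.integral_cpow_mul_exp_neg_mul_Ioi ha (div_pos hd hb),
    ← integral_const_mul, ← integral_indicator measurableSet_Ioi]
  congr 1
  ext x
  by_cases hx : 0 < x
  · simp only [Set.mem_Ioi, hx, Set.indicator_of_mem]
    exact integral_coneSlice hb a hx
  · simp [hx]

/-- The integrand `X ↦ etr (-B X) |X| ^ (a - 2)` in coordinates. -/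
noncomputable def coneDensity (b : ℝ × ℝ × ℂ) (a : ℂ) (c : ℝ × ℝ × ℂ) : ℂ :=
  (Real.exp (-hermPair b c) : ℂ) * (hermDet c : ℂ) ^ (a - 2)

theorem measurable_coneDensity (b : ℝ × ℝ × ℂ) (a : ℂ) : Measurable (coneDensity b a) := by
  have h1 := (continuous_hermPair b).measurable
  have h2 := continuous_hermDet.measurable
  unfold coneDensity; fun_prop

theorem indicator_coneDensity_coneShear (b : ℝ × ℝ × ℂ) (a : ℂ) (p : (ℝ × ℂ) × ℝ) :
    posDefCone2.indicator (coneDensity b a) (coneShear p) =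
      (Set.Ioi (0 : ℝ)).indicator (fun x => coneSlice b a x p.1.2) p.1.1 *
      (Set.Ioi (0 : ℝ)).indicator
        (fun v : ℝ => (v : ℂ) ^ (a - 1 - 1) * Complex.exp (-(b.2.1 * v))) p.2 := by
  obtain ⟨⟨x, z⟩, v⟩ := p
  by_cases hx : 0 < x
  · have hdet : hermDet (coneShear ((x, z), v)) = x * v := by
      simp only [hermDet, coneShear]; field_simp; ring
    have hmem : coneShear ((x, z), v) ∈ posDefCone2 ↔ 0 < v := by
      rw [mem_posDefCone2_iff, hdet]
      simp [coneShear, hx]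
    by_cases hv : 0 < v
    · rw [Set.indicator_of_mem (hmem.2 hv), Set.indicator_of_mem (Set.mem_Ioi.2 hx),
        Set.indicator_of_mem (Set.mem_Ioi.2 hv), coneDensity, hdet, Complex.ofReal_mul,
        Complex.mul_cpow_ofReal_nonneg hx.le hv.le]
      have e1 : a - 1 - 1 = a - 2 := by ring
      have hx' : (x : ℂ) ≠ 0 := by exact_mod_cast hx.ne'
      have e2 : (Real.exp (-hermPair b (coneShear ((x, z), v))) : ℂ) =
          Complex.exp (-(b.1 * x)) * Complex.exp (-((b.2.1 / x : ℝ) : ℂ) * ‖z‖ ^ 2 +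
            (-2) * (inner ℝ b.2.2 z : ℝ)) * Complex.exp (-(b.2.1 * v)) := by
        rw [Complex.ofReal_exp, ← Complex.exp_add, ← Complex.exp_add]
        congr 1
        simp only [hermPair, coneShear]
        push_cast
        field_simp
        ring
      rw [e1, e2, coneSlice]
      ring
    · rw [Set.indicator_of_notMem (mt hmem.1 hv),
        Set.indicator_of_notMem (s := Set.Ioi 0) (a := v) (by simpa using hv), mul_zero]
  · rw [Set.indicator_of_notMem,
      Set.indicator_of_notMem (s := Set.Ioi 0) (a := x) (by simpa using hx), zero_mul]
    rw [mem_posDefCone2_iff]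
    exact fun h => hx h.1

/-- After the shear the integrand is a product. The (x, z) factor needs only Re a > 0; the factor
v^(a-2) is what requires Re a > 1. -/
theorem integrableOn_coneDensity {b : ℝ × ℝ × ℂ} (hb : 0 < b.1) (hd : 0 < hermDet b)
    {a : ℂ} (ha : 1 < a.re) :
    IntegrableOn (coneDensity b a) posDefCone2 := by
  have hb2 := snd_pos_of_hermDet_pos hb hd
  have hS := isOpen_posDefCone2.measurableSet
  rw [← integrable_indicator_iff hS, ← measurePreserving_coneShear.integrable_comp
    ((measurable_coneDensity b a).indicator hS).aestronglyMeasurable]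
  simp_rw [Function.comp_def, indicator_coneDensity_coneShear]
  refine (integrable_indicator_coneSlice hb2 hd (by linarith)).mul_prod
    ((integrable_indicator_iff measurableSet_Ioi).2
      (integrableOn_cpow_mul_exp_neg_mul ?_ hb2))
  simpa using ha

theorem setIntegral_coneDensity {b : ℝ × ℝ × ℂ} (hb : 0 < b.1) (hd : 0 < hermDet b)
    {a : ℂ} (ha : 1 < a.re) :
    ∫ c in posDefCone2, coneDensity b a c =
    Real.pi * Complex.Gamma a * Complex.Gamma (a - 1) * (hermDet b : ℂ) ^ (-a) := by
  have hb2 := snd_pos_of_hermDet_pos hb hd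
  have hS := isOpen_posDefCone2.measurableSet
  have hb' : (b.2.1 : ℂ) ≠ 0 := by exact_mod_cast hb2.ne'
  rw [← integral_indicator hS, ← measurePreserving_coneShear.map_eq,
    integral_map measurePreserving_coneShear.measurable.aemeasurable
    ((measurable_coneDensity b a).indicator hS).aestronglyMeasurable]
  simp_rw [indicator_coneDensity_coneShear]
  rw [Measure.volume_eq_prod, integral_prod_mul
      (fun q : ℝ × ℂ => (Set.Ioi (0 : ℝ)).indicator (fun x => coneSlice b a x q.2) q.1)
      ((Set.Ioi (0 : ℝ)).indicator
        (fun v : ℝ => (v : ℂ) ^ (a - 1 - 1) * Complex.exp (-(b.2.1 * v)))),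
    integral_indicator_coneSlice hb2 hd (by linarith),
    integral_indicator measurableSet_Ioi,
    Complex.integral_cpow_mul_exp_neg_mul_Ioi (by simpa using ha) hb2]
  have e1 : (1 / ((hermDet b / b.2.1 : ℝ) : ℂ)) = ((b.2.1 * (hermDet b)⁻¹ : ℝ) : ℂ) := by
    push_cast; field_simp
  have e2 : (1 / (b.2.1 : ℂ)) = ((b.2.1⁻¹ : ℝ) : ℂ) := by
    push_cast; simp
  rw [e1, e2, Complex.ofReal_mul, Complex.mul_cpow_ofReal_nonneg hb2.le (by positivity)]
  have inv_cpow : ∀ {x : ℝ} (_ : 0 < x) (s : ℂ), ((x⁻¹ : ℝ) : ℂ) ^ s = (x : ℂ) ^ (-s) := by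
    intro x hx s
    rw [Complex.ofReal_inv, Complex.inv_cpow _ _ (by
      rw [Complex.arg_ofReal_of_nonneg hx.le]; exact Real.pi_pos.ne), Complex.cpow_neg]
  rw [inv_cpow hd, inv_cpow hb2]
  have e3 : (b.2.1 : ℂ) ^ a * (b.2.1 : ℂ) ^ (-(a - 1)) = b.2.1 := by
    rw [← Complex.cpow_add _ _ hb']; simp
  push_cast
  calc _ = Real.pi / b.2.1 * ((b.2.1 : ℂ) ^ a * (b.2.1 : ℂ) ^ (-(a - 1))) *
        ((hermDet b : ℂ) ^ (-a) * Complex.Gamma a * Complex.Gamma (a - 1)) := by ring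
    _ = _ := by rw [e3]; field_simp

/-! ### Higher derivatives of linear and quadratic powers; Gegenbauer polynomials. -/

theorem hasDerivAt_ofReal_comp_cpow {u : ℝ → ℝ} {u' r : ℝ} (hu : HasDerivAt u u' r)
    (hr : 0 < u r) (s : ℂ) :
    HasDerivAt (fun r => (u r : ℂ) ^ s) (s * u' * (u r : ℂ) ^ (s - 1)) r := by
  have h1 : HasDerivAt (fun z : ℂ => z ^ s) (s * (u r : ℂ) ^ (s - 1) * 1) (u r : ℂ) :=
    (hasDerivAt_id _).cpow_const (.inl (by simpa using hr))
  convert! h1.scomp r hu.ofReal_comp using 1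
  simp only [smul_eq_mul]
  ring

theorem iteratedDeriv_linear_cpow (d g : ℝ) (a : ℂ) (t : ℕ) :
    ∀ {s : ℝ}, 0 < d - s * g →
      iteratedDeriv t (fun s : ℝ => ((d - s * g : ℝ) : ℂ) ^ (-a)) s =
        (ascPochhammer ℂ t).eval a * (g : ℂ) ^ t * ((d - s * g : ℝ) : ℂ) ^ (-(a + t)) := by
  induction t with
  | zero => intro s _; simp
  | succ t ih =>
    intro s hs
    have hu : HasDerivAt (fun s : ℝ => d - s * g) (-g) s := by
      simpa using ((hasDerivAt_id s).mul_const g).const_sub d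
    have h := (hasDerivAt_ofReal_comp_cpow hu hs (-(a + t))).const_mul
      ((ascPochhammer ℂ t).eval a * (g : ℂ) ^ t)
    have e : -(a + t) - 1 = -(a + ((t + 1 : ℕ) : ℂ)) := by push_cast; ring
    rw [e] at h
    rw [iteratedDeriv_succ, Filter.EventuallyEq.deriv_eq (f := fun s : ℝ =>
      (ascPochhammer ℂ t).eval a * (g : ℂ) ^ t * ((d - s * g : ℝ) : ℂ) ^ (-(a + t))), h.deriv,
      ascPochhammer_succ_eval]
    · push_cast; ring
    · filter_upwards [(isOpen_lt continuous_const (by fun_prop : Continuous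
        fun s : ℝ => d - s * g)).mem_nhds hs] with x hx
      exact ih hx

theorem iteratedDeriv_linear_pow (g ρ : ℝ) (t k : ℕ) :
    ∀ r : ℝ, iteratedDeriv k (fun r : ℝ => ((g - r * ρ : ℝ) : ℂ) ^ t) r =
        (t.descFactorial k : ℂ) * (-ρ : ℂ) ^ k * ((g - r * ρ : ℝ) : ℂ) ^ (t - k) := by
  induction k with
  | zero => intro s; simp
  | succ k ih =>
    intro r
    have hu : HasDerivAt (fun s : ℝ => g - s * ρ) (-ρ) r := by
      simpa using ((hasDerivAt_id r).mul_const ρ).const_sub g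
    have h := (hu.ofReal_comp.fun_pow (t - k)).const_mul ((t.descFactorial k : ℂ) * (-ρ : ℂ) ^ k)
    rw [iteratedDeriv_succ, funext ih, h.deriv, Nat.descFactorial_succ, Nat.sub_sub]
    push_cast; ring

/-- The absolute value `n! / (k! (n - 2 k)!)` of the coefficient of `x ^ (n - 2 k)` in
`H_n (x / 2)`, for the Hermite polynomial `H_n`. -/
def hermiteCoeff : ℕ → ℕ → ℕ
  | _, 0 => 1
  | 0, _ + 1 => 0
  | n + 1, k + 1 => hermiteCoeff n (k + 1) + 2 * (n - 2 * k) * hermiteCoeff n k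

theorem hermiteCoeff_eq_zero {n : ℕ} : ∀ {k : ℕ}, n < 2 * k → hermiteCoeff n k = 0 := by
  induction n with
  | zero => rintro (_ | k) h <;> simp [hermiteCoeff] at *
  | succ n ih =>
    rintro (_ | k) h
    · simp at h
    · rw [hermiteCoeff, ih (by lia), zero_add]
      rcases Nat.lt_or_ge n (2 * k) with h' | h'
      · rw [ih h', mul_zero]
      · rw [show n - 2 * k = 0 by lia, mul_zero, zero_mul]

theorem hermiteCoeff_mul {n : ℕ} : ∀ {k : ℕ}, 2 * k ≤ n →
    hermiteCoeff n k * (k.factorial * (n - 2 * k).factorial) = n.factorial := by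
  induction n with
  | zero => rintro (_ | k) h <;> simp [hermiteCoeff] at *
  | succ n ih =>
    rintro (_ | k) h
    · simp [hermiteCoeff]
    · obtain ⟨m, rfl⟩ : ∃ m, n = 2 * k + (m + 1) := ⟨n - 2 * k - 1, by lia⟩
      have h2 := ih (k := k) (by lia)
      rw [hermiteCoeff]
      rw [show 2 * k + (m + 1) - 2 * k = m + 1 by lia] at h2 ⊢
      rw [show 2 * k + (m + 1) + 1 - 2 * (k + 1) = m by lia,
        Nat.factorial_succ (2 * k + (m + 1)), ← h2]
      rcases m with _ | m
      -- Here n = 2k + 1, so only the second term of the recursion survives.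
      · rw [hermiteCoeff_eq_zero (by lia)]
        simp only [Nat.factorial_succ]; ring
      · have h1 := ih (k := k + 1) (by lia)
        rw [show 2 * k + (m + 1 + 1) - 2 * (k + 1) = m by lia, ← h2] at h1
        simp only [Nat.factorial_succ] at h1 ⊢
        linear_combination (m + 1) * h1

/-- A further derivative of the k-th term either hits the power of the quadratic, which keeps k and
brings down ν + n - k and a factor τ - 2r, or hits the power of τ - 2r, which brings down -2(n - 2k)
and moves to k + 1. These are the two terms of the recursion for `hermiteCoeff`. Its vanishing for
2k > n lets the sum run up to n. -/
theorem iteratedDeriv_quadratic_cpow (d τ : ℝ) (ν : ℂ) (n : ℕ) :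
    ∀ {r : ℝ}, 0 < d - r * τ + r ^ 2 →
      iteratedDeriv n (fun r : ℝ => ((d - r * τ + r ^ 2 : ℝ) : ℂ) ^ (-ν)) r =
        ∑ k ∈ Finset.range (n + 1), (hermiteCoeff n k : ℂ) *
          ((-1) ^ k * (ascPochhammer ℂ (n - k)).eval ν * ((τ - 2 * r : ℝ) : ℂ) ^ (n - 2 * k) *
            ((d - r * τ + r ^ 2 : ℝ) : ℂ) ^ (-(ν + (n - k : ℕ)))) := by
  induction n with
  | zero => intro s _; simp [hermiteCoeff]
  | succ n ih =>
    intro r hr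
    have hq : HasDerivAt (fun r : ℝ => τ - 2 * r) (-2) r := by
      simpa using ((hasDerivAt_id r).const_mul 2).const_sub τ
    have hD : HasDerivAt (fun r : ℝ => d - r * τ + r ^ 2) (-(τ - 2 * r)) r := by
      have := (((hasDerivAt_id r).mul_const τ).const_sub d).add ((hasDerivAt_id r).pow 2)
      convert! this using 1
      simp; ring
    have hterm := fun k : ℕ => ((((hq.ofReal_comp.fun_pow (n - 2 * k)).const_mul
      ((-1) ^ k * (ascPochhammer ℂ (n - k)).eval ν)).fun_mul
      (hasDerivAt_ofReal_comp_cpow hD hr (-(ν + (n - k : ℕ))))).const_mul (hermiteCoeff n k : ℂ))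
    have hsum := HasDerivAt.fun_sum fun k (_ : k ∈ Finset.range (n + 1)) => hterm k
    rw [iteratedDeriv_succ, Filter.EventuallyEq.deriv_eq (f := fun r : ℝ =>
      ∑ k ∈ Finset.range (n + 1), (hermiteCoeff n k : ℂ) *
          ((-1) ^ k * (ascPochhammer ℂ (n - k)).eval ν * ((τ - 2 * r : ℝ) : ℂ) ^ (n - 2 * k) *
            ((d - r * τ + r ^ 2 : ℝ) : ℂ) ^ (-(ν + (n - k : ℕ))))), hsum.deriv]
    · set T : ℕ → ℂ := fun k => (-1) ^ k * (ascPochhammer ℂ (n + 1 - k)).eval ν *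
        ((τ - 2 * r : ℝ) : ℂ) ^ (n + 1 - 2 * k) *
            ((d - r * τ + r ^ 2 : ℝ) : ℂ) ^ (-(ν + (n + 1 - k : ℕ))) with hT
      have hrec : ∑ k ∈ Finset.range (n + 1 + 1), (hermiteCoeff (n + 1) k : ℂ) * T k =
          ∑ k ∈ Finset.range (n + 1), ((hermiteCoeff n k : ℂ) * T k +
            (2 * (n - 2 * k : ℕ) * hermiteCoeff n k : ℂ) * T (k + 1)) := by
        rw [Finset.sum_range_succ', Finset.sum_add_distrib]
        have h0 : ∑ k ∈ Finset.range (n + 1), (hermiteCoeff n k : ℂ) * T k =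
            ∑ k ∈ Finset.range (n + 1), (hermiteCoeff n (k + 1) : ℂ) * T (k + 1) +
              (hermiteCoeff n 0 : ℂ) * T 0 := by
          rw [← Finset.sum_range_succ' (fun k => (hermiteCoeff n k : ℂ) * T k),
            Finset.sum_range_succ _ (n + 1), hermiteCoeff_eq_zero (by lia)]
          simp
        rw [h0, add_right_comm, ← Finset.sum_add_distrib]
        simp only [hermiteCoeff]
        push_cast
        simp_rw [add_mul]
      rw [hrec]
      refine Finset.sum_congr rfl fun k hk => ?_
      have hk' : k ≤ n := by simpa [Nat.lt_succ_iff] using hk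
      have e1 : -(ν + ((n - k : ℕ) : ℂ)) - 1 = -(ν + ((n + 1 - k : ℕ) : ℂ)) := by
        rw [Nat.succ_sub hk']; push_cast; ring
      have e2 : (ascPochhammer ℂ (n + 1 - k)).eval ν =
          (ascPochhammer ℂ (n - k)).eval ν * (ν + ((n - k : ℕ) : ℂ)) := by
        rw [Nat.succ_sub hk', ascPochhammer_succ_eval]
      rw [e1]
      simp only [hT, Nat.add_sub_add_right, e2]
      rw [show n + 1 - 2 * (k + 1) = n - 2 * k - 1 by lia]
      rcases Nat.lt_or_ge n (2 * k) with h' | h'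
      · rw [hermiteCoeff_eq_zero h']; simp
      · rw [Nat.succ_sub h', Nat.succ_eq_add_one, pow_succ]
        push_cast
        ring
    · filter_upwards [(isOpen_lt continuous_const (by fun_prop : Continuous
        fun r : ℝ => d - r * τ + r ^ 2)).mem_nhds hr] with x hx
      exact ih hx

theorem eval_gegenbauer (ν x : ℂ) (n : ℕ) :
    (n.factorial : ℂ) * (gegenbauer ν n).eval x = ∑ k ∈ Finset.range (n + 1),
      (hermiteCoeff n k : ℂ) *
        ((-1) ^ k * (ascPochhammer ℂ (n - k)).eval ν * (2 * x) ^ (n - 2 * k)) := by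
  have hsub : Finset.range (n / 2 + 1) ⊆ Finset.range (n + 1) :=
    Finset.range_subset_range.2 (by lia)
  rw [← Finset.sum_subset hsub, gegenbauer, Polynomial.eval_finsetSum, Finset.mul_sum]
  · refine Finset.sum_congr rfl fun k hk => ?_
    rw [Finset.mem_range] at hk
    have h := hermiteCoeff_mul (n := n) (k := k) (by lia)
    rw [← h]
    have hk1 : (k.factorial : ℂ) ≠ 0 := by exact_mod_cast k.factorial_ne_zero
    have hk2 : ((n - 2 * k).factorial : ℂ) ≠ 0 := by exact_mod_cast (n - 2 * k).factorial_ne_zero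
    simp only [Polynomial.eval_mul, Polynomial.eval_C, Polynomial.eval_pow, Polynomial.eval_X,
      Polynomial.eval_ofNat]
    push_cast
    field_simp
  · intro k _ hk
    rw [Finset.mem_range] at hk
    rw [hermiteCoeff_eq_zero (by lia)]
    simp

/-- This is the Gegenbauer generating function after the scaling r ↦ r / √d, checked term by term:
each factor τ is paired with d^(-1/2). -/
theorem iteratedDeriv_quadratic_cpow_zero {d : ℝ} (hd : 0 < d) (τ : ℝ) (ν : ℂ) (n : ℕ) :
    iteratedDeriv n (fun r : ℝ => ((d - r * τ + r ^ 2 : ℝ) : ℂ) ^ (-ν)) 0 =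
      n.factorial * (d : ℂ) ^ (-(ν + n / 2)) *
        (gegenbauer ν n).eval (τ / (2 * (d : ℂ) ^ (1 / 2 : ℂ))) := by
  have hd' : (d : ℂ) ≠ 0 := by exact_mod_cast hd.ne'
  rw [iteratedDeriv_quadratic_cpow d τ ν n (by simpa using hd), mul_right_comm, eval_gegenbauer,
    Finset.sum_mul]
  refine Finset.sum_congr rfl fun k hk => ?_
  have hk' : k ≤ n := by simpa [Nat.lt_succ_iff] using hk
  rcases Nat.lt_or_ge n (2 * k) with h' | h'
  · rw [hermiteCoeff_eq_zero h']; simp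
  · have e : (2 * ((τ : ℂ) / (2 * (d : ℂ) ^ (1 / 2 : ℂ)))) = τ * (d : ℂ) ^ (-(1 / 2) : ℂ) := by
      rw [Complex.cpow_neg]; field_simp
    have e2 : ((d : ℂ) ^ (-(1 / 2) : ℂ)) ^ (n - 2 * k) * (d : ℂ) ^ (-(ν + n / 2)) =
        (d : ℂ) ^ (-(ν + (n - k : ℕ))) := by
      rw [← Complex.cpow_nat_mul, ← Complex.cpow_add _ _ hd']
      congr 1
      push_cast [Nat.cast_sub h', Nat.cast_sub hk']
      ring
    rw [e, mul_pow, mul_zero, sub_zero, show d - 0 * τ + 0 ^ 2 = d by ring, ← e2]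
    ring

theorem contDiffAt_linear_pow (g ρ : ℝ) (t : ℕ) (n : WithTop ℕ∞) (r : ℝ) :
    ContDiffAt ℝ n (fun r : ℝ => ((g - r * ρ : ℝ) : ℂ) ^ t) r := by
  have : ContDiffAt ℝ n (fun r : ℝ => g - r * ρ) r := by fun_prop
  exact (Complex.ofRealCLM.contDiff.contDiffAt.comp r this).pow t

theorem contDiffAt_quadratic_cpow {d τ r : ℝ} (hr : 0 < d - r * τ + r ^ 2) (ν : ℂ)
    (n : WithTop ℕ∞) :
    ContDiffAt ℝ n (fun r : ℝ => ((d - r * τ + r ^ 2 : ℝ) : ℂ) ^ (-ν)) r := by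
  have h1 : ContDiffAt ℝ n (fun r : ℝ => d - r * τ + r ^ 2) r := by fun_prop
  have h2 := Complex.ofRealCLM.contDiff.contDiffAt.comp r (h1.log hr.ne')
  -- Smoothness is read off from exp(-ν log D), with D the positive quadratic.
  have h3 := (h2.mul (contDiffAt_const (c := -ν))).cexp
  refine h3.congr_of_eventuallyEq ?_
  filter_upwards [(isOpen_lt continuous_const (by fun_prop : Continuous
        fun r : ℝ => d - r * τ + r ^ 2)).mem_nhds hr] with x (hx : 0 < d - x * τ + x ^ 2)
  rw [Complex.cpow_def_of_ne_zero (by exact_mod_cast hx.ne'), ← Complex.ofReal_log hx.le]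
  simp

theorem iteratedDeriv_linear_pow_mul_quadratic_cpow {d : ℝ} (hd : 0 < d) (g ρ τ : ℝ) (ν : ℂ)
    (t p : ℕ) :
    iteratedDeriv p (fun r : ℝ => ((g - r * ρ : ℝ) : ℂ) ^ t *
      ((d - r * τ + r ^ 2 : ℝ) : ℂ) ^ (-ν)) 0 =
    p.factorial * ∑ k ∈ Finset.range (min p t + 1), (-1) ^ k * (t.choose k : ℂ) *
      (g : ℂ) ^ (t - k) * (ρ : ℂ) ^ k * ((d : ℂ) ^ (-(ν + (p - k : ℕ) / 2)) *
        (gegenbauer ν (p - k)).eval (τ / (2 * (d : ℂ) ^ (1 / 2 : ℂ)))) := by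
  have hsub : Finset.range (min p t + 1) ⊆ Finset.range (p + 1) :=
    Finset.range_subset_range.2 (by lia)
  rw [iteratedDeriv_fun_mul (contDiffAt_linear_pow g ρ t p 0)
    (contDiffAt_quadratic_cpow (by simpa using hd) ν p), ← Finset.sum_subset hsub, Finset.mul_sum]
  · refine Finset.sum_congr rfl fun k hk => ?_
    have hk' : k ≤ p := by simp at hk; lia
    -- The factorials combine: C(p,k) · k! C(t,k) · (p-k)! = p! C(t,k).
    rw [iteratedDeriv_linear_pow, iteratedDeriv_quadratic_cpow_zero hd,
      Nat.descFactorial_eq_factorial_mul_choose, ← Nat.choose_mul_factorial_mul_factorial hk',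
      neg_pow (ρ : ℂ)]
    push_cast
    simp only [zero_mul, sub_zero]
    ring
  · intro k hk hk'
    simp only [Finset.mem_range] at hk hk'
    rw [iteratedDeriv_linear_pow, Nat.descFactorial_of_lt (by lia)]
    simp

/-! ### Perturbing the parameter matrix along a line. -/

/-- The trace of `herm2 q * (herm2 b).adjugate`. -/
noncomputable def hermAdj (q b : ℝ × ℝ × ℂ) : ℝ :=
  q.1 * b.2.1 + q.2.1 * b.1 - 2 * inner ℝ q.2.2 b.2.2

theorem trace_herm2_mul_adjugate (q b : ℝ × ℝ × ℂ) :
    (herm2 q * (herm2 b).adjugate).trace = (hermAdj q b : ℂ) := by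
  simp only [herm2, hermAdj, Matrix.trace_fin_two, Matrix.mul_apply, Fin.sum_univ_two,
    inner_complex_eq, Matrix.adjugate_fin_two_of]
  apply Complex.ext <;> simp <;> ring

theorem hermDet_sub_smul (b q : ℝ × ℝ × ℂ) (s : ℝ) :
    hermDet (b - s • q) = hermDet b - s * hermAdj q b + s ^ 2 * hermDet q := by
  simp only [hermDet, hermAdj, inner_complex_eq, sq_norm_complex_eq]
  simp
  ring

theorem hermPair_sub_smul (b q c : ℝ × ℝ × ℂ) (s : ℝ) :
    hermPair (b - s • q) c = hermPair b c - s * hermPair q c := by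
  simp only [hermPair, inner_complex_eq]
  simp
  ring

theorem hermAdj_sub_smul_one (q b : ℝ × ℝ × ℂ) (s : ℝ) :
    hermAdj q (b - s • (1, 1, 0)) = hermAdj q b - s * (q.1 + q.2.1) := by
  simp only [hermAdj, inner_complex_eq]
  simp
  ring

theorem hermDet_sub_smul_one (b : ℝ × ℝ × ℂ) (s : ℝ) :
    hermDet (b - s • (1, 1, 0)) = hermDet b - s * (b.1 + b.2.1) + s ^ 2 := by
  have h1 : hermDet (1, 1, 0) = 1 := by simp [hermDet]
  have h2 : hermAdj (1, 1, 0) b = b.1 + b.2.1 := by simp [hermAdj]; ring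
  rw [hermDet_sub_smul, h1, h2, mul_one]

theorem hermPair_one (c : ℝ × ℝ × ℂ) : hermPair (1, 1, 0) c = c.1 + c.2.1 := by
  simp [hermPair]

theorem coneDensity_sub_smul (b q : ℝ × ℝ × ℂ) (a : ℂ) (s : ℝ) (c : ℝ × ℝ × ℂ) :
    coneDensity (b - s • q) a c = (Real.exp (s * hermPair q c) : ℂ) * coneDensity b a c := by
  rw [coneDensity, coneDensity, hermPair_sub_smul, ← mul_assoc, ← Complex.ofReal_mul,
    ← Real.exp_add]
  ring_nf

theorem eventually_sub_smul_mem {b : ℝ × ℝ × ℂ} (hb : b ∈ posDefCone2) (q : ℝ × ℝ × ℂ) :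
    ∀ᶠ s : ℝ in nhds 0, b - s • q ∈ posDefCone2 := by
  have : Continuous fun s : ℝ => b - s • q := by fun_prop
  exact this.continuousAt.eventually_mem (isOpen_posDefCone2.mem_nhds (by simpa using hb))

theorem exists_pos_sub_smul_mem {b : ℝ × ℝ × ℂ} (hb : b ∈ posDefCone2) (q : ℝ × ℝ × ℂ) :
    ∃ ε : ℝ, 0 < ε ∧ b - ε • q ∈ posDefCone2 := by
  obtain ⟨δ, hδ, h⟩ := Metric.eventually_nhds_iff.1 (eventually_sub_smul_mem hb q)
  refine ⟨δ / 2, by positivity, h ?_⟩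
  rw [Real.dist_eq, sub_zero, abs_of_pos (by positivity)]
  linarith

theorem measurable_hermPair (q : ℝ × ℝ × ℂ) : Measurable (hermPair q) :=
  (continuous_hermPair q).measurable

/-! ### Moments of the cone density. -/

section PositiveDefinite

variable {b : ℝ × ℝ × ℂ} {a : ℂ}

theorem exists_integrable_exp_mul_coneDensity (hb : b ∈ posDefCone2) (ha : 1 < a.re)
    (q : ℝ × ℝ × ℂ) :
    ∃ δ : ℝ, 0 < δ ∧ Integrable (fun c => (Real.exp (δ * |hermPair q c|) : ℂ) * coneDensity b a c)
      (volume.restrict posDefCone2) := by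
  obtain ⟨ε, hε, hm⟩ := exists_pos_sub_smul_mem hb (1, 1, 0)
  set K := |q.1| + |q.2.1| + ‖q.2.2‖ with hK
  have hK0 : 0 ≤ K := by positivity
  -- By `abs_hermPair_le` this rate times |tr(QX)| is at most ε tr X; the 1 covers q = 0.
  refine ⟨ε / (K + 1), by positivity, ?_⟩
  have hm' := (mem_posDefCone2_iff _).1 hm
  refine (integrableOn_coneDensity hm'.1 hm'.2 ha).norm.mono' ?_ ?_
  · have h1 := measurable_hermPair q
    have h2 := measurable_coneDensity b a
    exact (by fun_prop : Measurable fun c =>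
      (Real.exp (ε / (K + 1) * |hermPair q c|) : ℂ) * coneDensity b a c).aestronglyMeasurable
  · filter_upwards [ae_restrict_mem isOpen_posDefCone2.measurableSet] with c hc
    obtain ⟨h1, h2⟩ := (mem_posDefCone2_iff c).1 hc
    rw [coneDensity_sub_smul, norm_mul, norm_mul, hermPair_one]
    simp only [Complex.norm_real, Real.norm_eq_abs, Real.abs_exp]
    refine mul_le_mul_of_nonneg_right (Real.exp_le_exp.2 ?_) (norm_nonneg _)
    rw [div_mul_eq_mul_div, div_le_iff₀ (by positivity), mul_assoc]
    refine mul_le_mul_of_nonneg_left ?_ hε.le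
    have := snd_pos_of_hermDet_pos h1 h2
    have := abs_hermPair_le h1 h2 q
    nlinarith

theorem integrableOn_hermPair_pow_mul_coneDensity (hb : b ∈ posDefCone2) (ha : 1 < a.re)
    (q : ℝ × ℝ × ℂ) (t : ℕ) :
    IntegrableOn (fun c => (hermPair q c : ℂ) ^ t * coneDensity b a c) posDefCone2 := by
  obtain ⟨δ, hδ, hint⟩ := exists_integrable_exp_mul_coneDensity hb ha q
  simpa [IntegrableOn] using integrable_pow_mul_exp_mul (measurable_hermPair q) hint (r := 0) (by simpa) t

/-- Differentiates the Laplace transform at b - s • q. The vanishing determinant of q removes the s²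
term, leaving a power of a linear function. -/
theorem setIntegral_hermPair_pow_mul_coneDensity (hb : b ∈ posDefCone2) (ha : 1 < a.re)
    {q : ℝ × ℝ × ℂ} (hq : hermDet q = 0) (t : ℕ) :
    ∫ c in posDefCone2, (hermPair q c : ℂ) ^ t * coneDensity b a c =
      (Real.pi * Complex.Gamma a * Complex.Gamma (a - 1) * (ascPochhammer ℂ t).eval a) *
        ((hermAdj q b : ℂ) ^ t * (hermDet b : ℂ) ^ (-(a + t))) := by
  obtain ⟨δ, hδ, hint⟩ := exists_integrable_exp_mul_coneDensity hb ha q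
  have h1 := iteratedDeriv_integral_exp_mul (measurable_hermPair q) hint t (r := 0) (by simpa)
  simp only [zero_mul, Real.exp_zero, Complex.ofReal_one, mul_one] at h1
  have hd := ((mem_posDefCone2_iff b).1 hb).2
  have h2 := iteratedDeriv_linear_cpow (hermDet b) (hermAdj q b) a t (s := 0) (by simpa)
  rw [← h1, Filter.EventuallyEq.iteratedDeriv_eq (g := fun s : ℝ =>
    (Real.pi * Complex.Gamma a * Complex.Gamma (a - 1)) *
      ((hermDet b - s * hermAdj q b : ℝ) : ℂ) ^ (-a)), iteratedDeriv_const_mul_field, h2]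
  · simp only [zero_mul, sub_zero]
    ring
  · filter_upwards [eventually_sub_smul_mem hb q] with s hs
    obtain ⟨hs1, hs2⟩ := (mem_posDefCone2_iff _).1 hs
    have h := setIntegral_coneDensity hs1 hs2 ha
    simp_rw [coneDensity_sub_smul] at h
    rw [h, hermDet_sub_smul, hq]
    simp

/-- The trace is positive on the cone, so the weight is exactly the shift of b by ε times the
identity. -/
theorem exists_integrable_exp_trace_mul_coneDensity (hb : b ∈ posDefCone2) (ha : 1 < a.re)
    (q : ℝ × ℝ × ℂ) (t : ℕ) :
    ∃ δ : ℝ, 0 < δ ∧ Integrable (fun c => (Real.exp (δ * |hermPair (1, 1, 0) c|) : ℂ) *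
      ((hermPair q c : ℂ) ^ t * coneDensity b a c)) (volume.restrict posDefCone2) := by
  obtain ⟨ε, hε, hm⟩ := exists_pos_sub_smul_mem hb (1, 1, 0)
  refine ⟨ε, hε, (integrableOn_hermPair_pow_mul_coneDensity hm ha q t).congr ?_⟩
  filter_upwards [ae_restrict_mem isOpen_posDefCone2.measurableSet] with c hc
  obtain ⟨h1, h2⟩ := (mem_posDefCone2_iff c).1 hc
  have := snd_pos_of_hermDet_pos h1 h2
  rw [coneDensity_sub_smul, abs_of_pos (by rw [hermPair_one]; positivity)]
  ring

theorem integrableOn_trace_pow_mul_hermPair_pow (hb : b ∈ posDefCone2) (ha : 1 < a.re)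
    (q : ℝ × ℝ × ℂ) (p t : ℕ) :
    IntegrableOn (fun c => (hermPair (1, 1, 0) c : ℂ) ^ p *
      ((hermPair q c : ℂ) ^ t * coneDensity b a c)) posDefCone2 := by
  obtain ⟨δ, hδ, hint⟩ := exists_integrable_exp_trace_mul_coneDensity hb ha q t
  simpa [IntegrableOn] using integrable_pow_mul_exp_mul (measurable_hermPair _) hint (r := 0) (by simpa) p

/-- Differentiates the previous moment formula, now as a function of r at b - r • (1, 1, 0), where
it is a linear power times a quadratic power. -/
theorem setIntegral_trace_pow_mul_hermPair_pow (hb : b ∈ posDefCone2) (ha : 1 < a.re)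
    {q : ℝ × ℝ × ℂ} (hq : hermDet q = 0) (p t : ℕ) :
    ∫ c in posDefCone2, (hermPair (1, 1, 0) c : ℂ) ^ p *
      ((hermPair q c : ℂ) ^ t * coneDensity b a c) =
    (Real.pi * Complex.Gamma a * Complex.Gamma (a - 1) * (ascPochhammer ℂ t).eval a) *
      (p.factorial * ∑ k ∈ Finset.range (min p t + 1), (-1) ^ k * (t.choose k : ℂ) *
        (hermAdj q b : ℂ) ^ (t - k) * ((q.1 + q.2.1 : ℝ) : ℂ) ^ k *
        ((hermDet b : ℂ) ^ (-(a + t + (p - k : ℕ) / 2)) * (gegenbauer (a + t) (p - k)).eval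
          (((b.1 + b.2.1 : ℝ) : ℂ) / (2 * (hermDet b : ℂ) ^ (1 / 2 : ℂ))))) := by
  obtain ⟨δ, hδ, hint⟩ := exists_integrable_exp_trace_mul_coneDensity hb ha q t
  have h1 := iteratedDeriv_integral_exp_mul (measurable_hermPair _) hint p (r := 0) (by simpa)
  simp only [zero_mul, Real.exp_zero, Complex.ofReal_one, mul_one] at h1
  have hd := ((mem_posDefCone2_iff b).1 hb).2
  rw [← iteratedDeriv_linear_pow_mul_quadratic_cpow hd, ← iteratedDeriv_const_mul_field, ← h1]
  apply Filter.EventuallyEq.iteratedDeriv_eq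
  filter_upwards [eventually_sub_smul_mem hb (1, 1, 0)] with r hr
  have h := setIntegral_hermPair_pow_mul_coneDensity hr ha hq t
  simp_rw [coneDensity_sub_smul] at h
  rw [hermAdj_sub_smul_one, hermDet_sub_smul_one] at h
  rw [← h]
  congr 1
  ext c
  ring

end PositiveDefinite

/-! ### Return to matrices. -/

theorem traceIntegrand_herm2 (b q : ℝ × ℝ × ℂ) (p t : ℕ) (a : ℂ) (c : ℝ × ℝ × ℂ) :
    traceIntegrand (herm2 b) (herm2 q) p t a (herm2 c) =
      (hermPair (1, 1, 0) c : ℂ) ^ p * ((hermPair q c : ℂ) ^ t * coneDensity b a c) := by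
  rw [traceIntegrand, trace_herm2_mul, trace_herm2_mul, trace_herm2, det_herm2, hermPair_one,
    coneDensity]
  push_cast
  ring

theorem complexMultiGamma_two (a : ℂ) :
    complexMultiGamma 2 a = Real.pi * Complex.Gamma a * Complex.Gamma (a - 1) := by
  rw [complexMultiGamma, show Finset.Icc 1 2 = ({1, 2} : Finset ℕ) by decide,
    Finset.prod_pair (by norm_num)]
  push_cast
  rw [show a - 2 + 1 = a - 1 by ring]
  simp [mul_assoc]

theorem det_eq_zero_of_rank_eq_one {R : Matrix (Fin 2) (Fin 2) ℂ} (hR : R.rank = 1) :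
    R.det = 0 := by
  by_contra h
  have := Matrix.rank_of_isUnit R ((Matrix.isUnit_iff_isUnit_det R).2 (isUnit_iff_ne_zero.2 h))
  simp [hR] at this

theorem trace_herm2_mul_inv (q : ℝ × ℝ × ℂ) {b : ℝ × ℝ × ℂ} (hd : hermDet b ≠ 0) :
    (herm2 q * (herm2 b)⁻¹).trace = (hermAdj q b : ℂ) / hermDet b := by
  rw [Matrix.inv_def, Matrix.mul_smul, Matrix.trace_smul, trace_herm2_mul_adjugate, det_herm2,
    Ring.inverse_eq_inv', smul_eq_mul]
  field_simp

theorem lemma5 (A R : Matrix (Fin 2) (Fin 2) ℂ) (hA : A.PosDef) (hR : R.IsHermitian)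
    (hR1 : R.rank = 1) (p t : ℕ) (a : ℂ) (ha : 1 < a.re) :
    IntegrableOn (fun c : ℝ × ℝ × ℂ => traceIntegrand A R p t a (herm2 c)) posDefCone2 volume ∧
    ∫ c in posDefCone2, traceIntegrand A R p t a (herm2 c) =
      (p.factorial : ℂ) *
        ((ascPochhammer ℂ t).eval a * complexMultiGamma 2 a / A.det ^ (a + (p : ℂ) / 2)) *
        ∑ k ∈ Finset.range (min p t + 1),
          (-1) ^ k * (t.choose k : ℂ) / A.det ^ ((k : ℂ) / 2) *
            (R * A⁻¹).trace ^ (t - k) * R.trace ^ k *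
            (gegenbauer (a + t) (p - k)).eval (A.trace / (2 * A.det ^ (1 / 2 : ℂ))) := by
  obtain ⟨b, rfl⟩ := exists_herm2_eq hA.isHermitian
  obtain ⟨q, rfl⟩ := exists_herm2_eq hR
  have hb : b ∈ posDefCone2 := hA
  have hq : hermDet q = 0 := by
    have := det_eq_zero_of_rank_eq_one hR1
    rwa [det_herm2, Complex.ofReal_eq_zero] at this
  have hd : hermDet b ≠ 0 := ((mem_posDefCone2_iff b).1 hb).2.ne'
  have hd' : (hermDet b : ℂ) ≠ 0 := by exact_mod_cast hd
  simp_rw [traceIntegrand_herm2]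
  refine ⟨integrableOn_trace_pow_mul_hermPair_pow hb ha q p t, ?_⟩
  rw [setIntegral_trace_pow_mul_hermPair_pow hb ha hq, complexMultiGamma_two, det_herm2,
    trace_herm2_mul_inv q hd, trace_herm2, trace_herm2, ← mul_assoc, Finset.mul_sum,
    Finset.mul_sum]
  refine Finset.sum_congr rfl fun k hk => ?_
  obtain ⟨hkp, hkt⟩ : k ≤ p ∧ k ≤ t := by simp at hk; lia
  -- The exponent splits as (a + p/2) + k/2 + (t - k); the last part converts tr(R adj A)^(t-k) into
  -- tr(RA⁻¹)^(t-k).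
  have e : (hermDet b : ℂ) ^ (-(a + t + (p - k : ℕ) / 2)) =
      ((hermDet b : ℂ) ^ (a + (p : ℂ) / 2) * (hermDet b : ℂ) ^ ((k : ℂ) / 2) *
        (hermDet b : ℂ) ^ (t - k))⁻¹ := by
    rw [← Complex.cpow_natCast, ← Complex.cpow_add _ _ hd', ← Complex.cpow_add _ _ hd',
      ← Complex.cpow_neg]
    congr 1
    push_cast [Nat.cast_sub hkp, Nat.cast_sub hkt]
    ring
  rw [e, div_pow]
  simp only [div_eq_mul_inv, mul_inv]
  ring
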